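/- Let $a<b$ be real numbers. A symmetric kernel $K:[a,b]\times[a,b]\to\mathbb{R}$ is called positive definite if $\sum_{i,j=1}^N c_ic_jK(x_i,x_j)\ge 0$ for all $N$, all $c_1,\dots,c_N\in\mathbb{R}$ and all $x_1,\dots,x_N\in[a,b]$, and indefinite if neither $K$ nor $-K$ is positive definite. A Mercer's expansion of a continuous kernel $K$ (of infinite rank) is a series $\sum_{n=1}^\infty \sigma_n u_n(x)v_n(y)$ that equals $K$ in $L^2([a,b]^2)$, where $\sigma_1\ge\sigma_2\ge\cdots>0$, the functions $(u_n)$ and $(v_n)$ are continuous on $[a,b]$ and each family is orthonormal in $L^2([a,b])$, and $$\int_a^b K(x,y)v_n(y)\,dy=\sigma_nu_n(x),\qquad \int_a^b K(x,y)u_n(x)\,dx=\sigma_nv_n(y)\qquad (x,y\in[a,b],\ n\ge 1).$$ **Proposition.** (1) For all real $a<b$ there exists a continuous symmetric indefinite kernel $K:[a,b]\times[a,b]\to\mathbb{R}$ with a Mercer's expansion that converges to $K(x,y)$ at every point $(x,y)\in[a,b]\times[a,b]$, but fails to converge absolutely at some point of $[a,b]\times[a,b]$. (2) On $[-1,1]$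 the following kernel is an example. Let $\tilde P_n(x)=\sqrt{\tfrac{2n+1}{2}}\,P_n(x)$, where $P_n(x)=\frac{1}{2^nn!}\frac{d^n}{dx^n}(x^2-1)^n$ is the Legendre polynomial of degree $n$. The series $$K_{\mathrm{abs}}(x,y)=\sum_{n=1}^\infty\frac{(-1)^n}{n^2}\tilde P_{2n}(x)\tilde P_{2n}(y)$$ converges for every $(x,y)\in[-1,1]\times[-1,1]$; its sum $K_{\mathrm{abs}}$ is a continuous symmetric indefinite kernel; the series is a Mercer's expansion of $K_{\mathrm{abs}}$, with $\sigma_n=\frac1{n^2}$, $u_n=\tilde P_{2n}$ and $v_n=(-1)^n\tilde P_{2n}$; and there is a point of $[-1,1]\times[-1,1]$ at which it does not converge absolutely. -/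

import Mathlib

open Set Filter Topology

namespace MercerKernel

/-- Positive definiteness of a kernel on `[a, b]` (with `≥ 0`, as usual for kernels):
all quadratic forms `∑ cᵢ cⱼ K(xᵢ, xⱼ)` are nonnegative. -/
def IsPosDef (a b : ℝ) (K : ℝ → ℝ → ℝ) : Prop :=
  ∀ (N : ℕ) (c x : Fin N → ℝ), (∀ i, x i ∈ Icc a b) →
    0 ≤ ∑ i, ∑ j, c i * c j * K (x i) (x j)

/-- An indefinite kernel on `[a, b]`: neither `K` nor `-K` is positive definite. -/
def IsIndefinite (a b : ℝ) (K : ℝ → ℝ → ℝ) : Prop :=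
  ¬ IsPosDef a b K ∧ ¬ IsPosDef a b (fun x y => -K x y)

/-- A continuous symmetric indefinite kernel on `[a, b] × [a, b]`; only the values of `K` on
this square matter. -/
structure IsContSymmIndefinite (a b : ℝ) (K : ℝ → ℝ → ℝ) : Prop where
  continuousOn : ContinuousOn (fun p : ℝ × ℝ => K p.1 p.2) (Icc a b ×ˢ Icc a b)
  symm : ∀ x ∈ Icc a b, ∀ y ∈ Icc a b, K x y = K y x
  indefinite : IsIndefinite a b K

/-- The functions `u 0, u 1, …` are continuous on `[a, b]` and orthonormal in `L²([a, b])`. -/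
structure IsContOrthonormal (a b : ℝ) (u : ℕ → ℝ → ℝ) : Prop where
  continuousOn : ∀ n, ContinuousOn (u n) (Icc a b)
  orthonormal : ∀ m n, ∫ x in a..b, u m x * u n x = if m = n then 1 else 0

/-- `∑ₙ σₙ uₙ(x) vₙ(y)` is a Mercer's expansion (singular value expansion with continuous
singular functions) of the kernel `K` of infinite rank on `[a, b] × [c, d]`.  The last field, equality
in the `L²` sense, says that no positive singular value is missing from the list. -/
structure IsMercerExpansion (a b c d : ℝ) (K : ℝ → ℝ → ℝ)
    (σ : ℕ → ℝ) (u v : ℕ → ℝ → ℝ) : Prop where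
  pos : ∀ n, 0 < σ n
  antitone : Antitone σ
  left : IsContOrthonormal a b u
  right : IsContOrthonormal c d v
  integral_left : ∀ n, ∀ x ∈ Icc a b, ∫ y in c..d, K x y * v n y = σ n * u n x
  integral_right : ∀ n, ∀ y ∈ Icc c d, ∫ x in a..b, K x y * u n x = σ n * v n y
  tendsto_L2 : Tendsto
    (fun N : ℕ => ∫ x in a..b, ∫ y in c..d,
      (K x y - ∑ n ∈ Finset.range N, σ n * u n x * v n y) ^ 2) atTop (𝓝 0)

/-- The partial sums of `∑ₙ σₙ uₙ(x) vₙ(y)`, in the given order, converge to `K(x, y)` at every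
point of `[a, b] × [c, d]`. -/
def ConvergesPointwise (a b c d : ℝ) (K : ℝ → ℝ → ℝ) (σ : ℕ → ℝ) (u v : ℕ → ℝ → ℝ) : Prop :=
  ∀ x ∈ Icc a b, ∀ y ∈ Icc c d,
    Tendsto (fun N : ℕ => ∑ n ∈ Finset.range N, σ n * u n x * v n y) atTop (𝓝 (K x y))

/-- The series `∑ₙ |σₙ uₙ(x) vₙ(y)|` is finite at every point of `[a, b] × [c, d]`. -/
def ConvergesAbsolutely (a b c d : ℝ) (σ : ℕ → ℝ) (u v : ℕ → ℝ → ℝ) : Prop :=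
  ∀ x ∈ Icc a b, ∀ y ∈ Icc c d, Summable (fun n : ℕ => |σ n * u n x * v n y|)

/-- The Legendre polynomial `Pₙ`, by Rodrigues' formula. -/
noncomputable def legendre (n : ℕ) : Polynomial ℝ :=
  Polynomial.C (1 / (2 ^ n * (n.factorial : ℝ))) *
    Polynomial.derivative^[n] ((Polynomial.X ^ 2 - 1) ^ n)

/-- The Legendre polynomial of degree `n` normalized in `L²([-1, 1])`, as a function. -/
noncomputable def normLegendre (n : ℕ) (x : ℝ) : ℝ :=
  Real.sqrt ((2 * (n : ℝ) + 1) / 2) * (legendre n).eval x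

end MercerKernel

/-! With signs removed, the terms are b_n = w_n P_{2n+2}(x) P_{2n+2}(y), where w_n behaves like 2/n.
At (1,1) every Legendre polynomial is 1, so the absolute series there is the divergent sum of w_n.
The alternating series nevertheless converges uniformly: by summation by parts it suffices that b_n
tends uniformly to 0 and that the differences b_n - b_{n+1} have a summable uniform bound.

That bound is the crux. Sonin's function shows that P_{2n+2} - P_{2n} is largest at the origin
(`abs_eval_legendre_sub_le`), where it is of order n^{-1/2}. The extra factor w_n makes this
summable, and the central binomial ratios let it telescope (`abs_legendreTerm_sub_le`).

Uniform convergence yields continuity, the integral equations, L² equality and pointwise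
convergence. Indefiniteness is read off from K(1,1) < 0 and one positive two-point form. An affine
change of variable transports the example to any [a,b]. -/

namespace MercerKernel

/-! ### Legendre polynomials: differential equation, recurrences, special values. -/

section Polynomial

open Polynomial

theorem C_two_real : (C 2 : ℝ[X]) = 2 := rfl

theorem mul_derivative_pow_X_sq_sub_one (n : ℕ) :
    (X ^ 2 - 1 : ℝ[X]) * derivative ((X ^ 2 - 1) ^ n) = 2 * (n : ℝ[X]) * X * (X ^ 2 - 1) ^ n := by
  rcases n with _ | n
  · simp
  · simp only [derivative_pow, derivative_sub, derivative_X, derivative_one]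
    simp [C_two_real]
    ring

/-- Leibniz's rule applied to (X² - 1) y' = 2nXy differentiated n + 1 times, with y = (X² - 1)^n. -/
theorem iterate_derivative_pow_X_sq_sub_one_ode (n : ℕ) :
    (X ^ 2 - 1 : ℝ[X]) * derivative^[n + 2] ((X ^ 2 - 1) ^ n)
      + 2 * X * derivative^[n + 1] ((X ^ 2 - 1) ^ n)
      = (n : ℝ[X]) * ((n : ℝ[X]) + 1) * derivative^[n] ((X ^ 2 - 1) ^ n) := by
  have h1 := congrArg derivative (mul_derivative_pow_X_sq_sub_one n)
  set y : ℝ[X] := (X ^ 2 - 1) ^ n with hy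
  have h2 : derivative^[2] y * X ^ 2 - derivative^[2] y + ((2 : ℕ) : ℝ[X]) * (derivative y * X)
      - ((2 * n : ℕ) : ℝ[X]) * (derivative y * X) - ((2 * n : ℕ) : ℝ[X]) * y = 0 := by
    simp only [derivative_mul, derivative_sub, derivative_X_pow, derivative_one, derivative_X,
      derivative_natCast, derivative_ofNat] at h1
    simp only [Function.iterate_succ, Function.iterate_zero, Function.comp_apply, id]
    push_cast
    simp [C_two_real] at h1
    linear_combination h1
  have h3 := congrArg (derivative^[n]) h2
  simp only [iterate_derivative_sub, iterate_map_add, iterate_derivative_natCast_mul,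
    iterate_derivative_derivative_mul_X_sq, iterate_derivative_derivative_mul_X,
    iterate_derivative_zero, ← Function.iterate_add_apply, nsmul_eq_mul] at h3
  have h4 : ((n * (n - 1) : ℕ) : ℝ[X]) = n * n - n := by
    rcases n with _ | n
    · simp
    · push_cast [Nat.add_sub_cancel]; ring
  rw [h4] at h3
  push_cast at h3
  linear_combination h3

theorem legendre_ode (n : ℕ) :
    (1 - X ^ 2 : ℝ[X]) * derivative (derivative (legendre n)) - 2 * X * derivative (legendre n)
      + (n : ℝ[X]) * ((n : ℝ[X]) + 1) * legendre n = 0 := by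
  have h := iterate_derivative_pow_X_sq_sub_one_ode n
  rw [Function.iterate_succ_apply', Function.iterate_succ_apply'] at h
  simp only [legendre, derivative_C_mul]
  linear_combination -C (1 / (2 ^ n * (n.factorial : ℝ))) * h

theorem legendre_zero : legendre 0 = 1 := by simp [legendre]

theorem legendre_one : legendre 1 = X := by
  have h : derivative (X ^ 2 - 1 : ℝ[X]) = C 2 * X := by simp [C_two_real, one_add_one_eq_two]
  simp only [legendre, pow_one, Function.iterate_one, h, ← mul_assoc, ← C_mul]
  norm_num

/-- Two derivatives of (X² - 1)^(n+2) produce a term X²(X² - 1)^n; writing X² = (X² - 1) + 1 leaves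
only the two lower powers, and n + 1 further derivatives give Rodrigues' expressions. -/
theorem derivative_legendre_add_two (n : ℕ) :
    derivative (legendre (n + 2)) =
      (2 * (n : ℝ[X]) + 3) * legendre (n + 1) + derivative (legendre n) := by
  have h : derivative (derivative ((X ^ 2 - 1 : ℝ[X]) ^ (n + 2))) =
      ((2 * (n + 2) * (2 * n + 3) : ℕ) : ℝ[X]) * (X ^ 2 - 1) ^ (n + 1)
      + ((4 * (n + 2) * (n + 1) : ℕ) : ℝ[X]) * (X ^ 2 - 1) ^ n := by
    simp only [derivative_pow, derivative_sub, derivative_X, derivative_one, derivative_mul,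
      map_natCast, derivative_natCast, Nat.cast_ofNat]
    simp [pow_succ, C_two_real]
    ring
  have hc1 : (1 / (2 ^ (n + 2) * ((n + 2).factorial : ℝ))) * ((2 * (n + 2) * (2 * n + 3) : ℕ) : ℝ)
      = (2 * n + 3) * (1 / (2 ^ (n + 1) * ((n + 1).factorial : ℝ))) := by
    rw [Nat.factorial_succ (n + 1)]
    have := Nat.factorial_ne_zero (n + 1)
    push_cast
    field_simp
    ring
  have hc2 : (1 / (2 ^ (n + 2) * ((n + 2).factorial : ℝ))) * ((4 * (n + 2) * (n + 1) : ℕ) : ℝ)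
      = 1 / (2 ^ n * (n.factorial : ℝ)) := by
    rw [Nat.factorial_succ (n + 1), Nat.factorial_succ n]
    have := Nat.factorial_ne_zero n
    push_cast
    field_simp
    ring
  have e1 := congrArg (C : ℝ → ℝ[X]) hc1
  have e2 := congrArg (C : ℝ → ℝ[X]) hc2
  rw [C_mul, C_mul, map_natCast] at e1
  rw [C_mul, map_natCast] at e2
  have e3 : C (2 * (n : ℝ) + 3) = 2 * (n : ℝ[X]) + 3 := by
    simp only [C_add, C_mul, map_natCast]; rfl
  rw [e3] at e1
  have h1 : derivative (derivative^[n + 2] ((X ^ 2 - 1 : ℝ[X]) ^ (n + 2))) =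
      ((2 * (n + 2) * (2 * n + 3) : ℕ) : ℝ[X]) * derivative^[n + 1] ((X ^ 2 - 1 : ℝ[X]) ^ (n + 1))
      + ((4 * (n + 2) * (n + 1) : ℕ) : ℝ[X]) * derivative^[n + 1] ((X ^ 2 - 1 : ℝ[X]) ^ n) := by
    rw [← iterate_derivative_natCast_mul, ← iterate_derivative_natCast_mul, ← iterate_map_add, ← h]
    exact (Function.iterate_succ_apply' derivative (n + 2) _).symm
  simp only [legendre, derivative_C_mul, h1]
  rw [← Function.iterate_succ_apply' derivative n]
  linear_combination
    derivative^[n + 1] ((X ^ 2 - 1 : ℝ[X]) ^ (n + 1)) * e1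
      + derivative^[n + 1] ((X ^ 2 - 1 : ℝ[X]) ^ n) * e2

theorem eval_legendre_succ {ε : ℝ} (hε : ε ^ 2 = 1) (n : ℕ) :
    (legendre (n + 1)).eval ε = ε * (legendre n).eval ε := by
  have h : derivative ((X ^ 2 - 1 : ℝ[X]) ^ (n + 1)) =
      ((2 * (n + 1) : ℕ) : ℝ[X]) * ((X ^ 2 - 1) ^ n * X) := by
    simp only [derivative_pow, derivative_sub, derivative_X, derivative_one,
      Nat.add_sub_cancel]
    simp [C_two_real]
    ring
  -- The second Leibniz term dies at ±1: after n - 1 derivatives one factor X² - 1 survives. The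
  -- factor n covers n = 0, where n - 1 truncates.
  have h0 : (n : ℝ) * (derivative^[n - 1] ((X ^ 2 - 1 : ℝ[X]) ^ n)).eval ε = 0 := by
    rcases n with _ | n
    · simp
    · obtain ⟨r, hr⟩ := pow_sub_dvd_iterate_derivative_pow (X ^ 2 - 1 : ℝ[X]) (n + 1) n
      simp [hr, hε]
  simp only [legendre, Function.iterate_succ_apply, h, iterate_derivative_natCast_mul,
    iterate_derivative_mul_X, eval_mul, eval_C, eval_add, eval_natCast, eval_X, nsmul_eq_mul, h0,
    Nat.factorial_succ]
  have := Nat.factorial_ne_zero n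
  push_cast
  field_simp
  ring

theorem eval_legendre_of_sq_eq_one {ε : ℝ} (hε : ε ^ 2 = 1) (n : ℕ) :
    (legendre n).eval ε = ε ^ n := by
  induction n with
  | zero => simp [legendre_zero]
  | succ n ih => rw [eval_legendre_succ hε, ih, pow_succ']

theorem eval_one_legendre (n : ℕ) : (legendre n).eval 1 = 1 := by
  simp [eval_legendre_of_sq_eq_one (one_pow 2) n]

theorem eval_neg_one_legendre (n : ℕ) : (legendre n).eval (-1) = (-1) ^ n :=
  eval_legendre_of_sq_eq_one (by norm_num) n

theorem eval_zero_legendre (n : ℕ) :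
    (legendre n).eval 0 = 1 / 2 ^ n * ((X ^ 2 - 1 : ℝ[X]) ^ n).coeff n := by
  rw [legendre, eval_mul, eval_C, ← coeff_zero_eq_eval_zero, coeff_iterate_derivative, zero_add,
    Nat.descFactorial_self, nsmul_eq_mul]
  have := Nat.factorial_ne_zero n
  field_simp

theorem X_sq_sub_one_pow_eq_expand (n : ℕ) :
    (X ^ 2 - 1 : ℝ[X]) ^ n = expand ℝ 2 ((X + C (-1)) ^ n) := by
  simp [sub_eq_add_neg]

theorem eval_zero_legendre_odd (n : ℕ) : (legendre (2 * n + 1)).eval 0 = 0 := by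
  rw [eval_zero_legendre, X_sq_sub_one_pow_eq_expand, coeff_expand two_pos, if_neg (by lia),
    mul_zero]

theorem eval_zero_legendre_even (n : ℕ) :
    (legendre (2 * n)).eval 0 = (-1) ^ n * (n.centralBinom / 4 ^ n) := by
  rw [eval_zero_legendre, X_sq_sub_one_pow_eq_expand, coeff_expand two_pos,
    if_pos (dvd_mul_right _ _), Nat.mul_div_cancel_left _ two_pos, coeff_X_add_C_pow,
    Nat.centralBinom, show 2 * n - n = n by lia, pow_mul]
  norm_num
  ring

/-- The derivative of `legendre (n + 1)` in terms of its two neighbours. -/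
theorem one_sub_X_sq_mul_derivative_legendre (n : ℕ) :
    (2 * (n : ℝ[X]) + 3) * ((1 - X ^ 2) * derivative (legendre (n + 1))) =
      -(((n : ℝ[X]) + 1) * ((n : ℝ[X]) + 2) * (legendre (n + 2) - legendre n)) := by
  set h : ℝ[X] := (2 * (n : ℝ[X]) + 3) * ((1 - X ^ 2) * derivative (legendre (n + 1)))
    + ((n : ℝ[X]) + 1) * ((n : ℝ[X]) + 2) * (legendre (n + 2) - legendre n) with hh
  -- The differential equation and the recurrence make `h` constant; it vanishes at 1.
  have hd : derivative h = 0 := by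
    have h1 := legendre_ode (n + 1)
    have h2 := derivative_legendre_add_two n
    simp only [hh, derivative_add, derivative_mul, derivative_sub, h2, derivative_natCast,
      derivative_ofNat, derivative_one, derivative_X_pow]
    push_cast at h1 ⊢
    simp only [map_ofNat]
    linear_combination (2 * (n : ℝ[X]) + 3) * h1
  have hc := eq_C_of_derivative_eq_zero hd
  have h1 : h.eval 1 = 0 := by simp [hh, eval_mul, eval_one_legendre]
  rw [hc, eval_C] at h1
  rw [h1, C_0] at hc
  linear_combination hc

end Polynomial

/-! ### Orthogonality and norms of the Legendre polynomials. -/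

section Orthogonality

open Polynomial

theorem integral_eval_derivative (p : ℝ[X]) (a b : ℝ) :
    ∫ x in a..b, (derivative p).eval x = p.eval b - p.eval a :=
  intervalIntegral.integral_eq_sub_of_hasDerivAt (fun x _ => p.hasDerivAt x)
    ((derivative p).continuous.intervalIntegrable _ _)

/-- Sturm–Liouville argument: the product, scaled by the difference of eigenvalues, is the
derivative of (1 - x²) times the Wronskian, which vanishes at ±1. -/
theorem integral_legendre_mul_legendre_of_ne {m n : ℕ} (h : m ≠ n) :
    ∫ x in (-1 : ℝ)..1, (legendre m).eval x * (legendre n).eval x = 0 := by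
  have hne : ((m : ℝ) * (m + 1) - n * (n + 1)) ≠ 0 := by
    have : (m : ℝ) * (m + 1) - n * (n + 1) = (m - n) * (m + n + 1) := by ring
    rw [this]
    exact mul_ne_zero (sub_ne_zero.2 (Nat.cast_injective.ne h)) (by positivity)
  have hp : C ((m : ℝ) * (m + 1) - n * (n + 1)) * (legendre m * legendre n) =
      derivative ((1 - X ^ 2) *
        (derivative (legendre n) * legendre m - derivative (legendre m) * legendre n)) := by
    have hm := legendre_ode m
    have hn := legendre_ode n
    simp only [C_sub, C_mul, C_add, C_1, map_natCast, derivative_mul, derivative_sub,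
      derivative_one, derivative_X_pow]
    simp only [Nat.cast_ofNat]
    linear_combination legendre n * hm - legendre m * hn
  have := integral_eval_derivative ((1 - X ^ 2) *
    (derivative (legendre n) * legendre m - derivative (legendre m) * legendre n)) (-1) 1
  rw [← hp] at this
  simp only [eval_mul, eval_C, intervalIntegral.integral_const_mul] at this
  simpa [hne] using this

theorem intervalIntegrable_eval_mul_eval (p q : ℝ[X]) (a b : ℝ) :
    IntervalIntegrable (fun x => p.eval x * q.eval x) MeasureTheory.volume a b :=
  (p.continuous.mul q.continuous).intervalIntegrable _ _

theorem eval_derivative_legendre_add_two (n : ℕ) (x : ℝ) :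
    (derivative (legendre (n + 2))).eval x =
      (2 * (n : ℝ) + 3) * (legendre (n + 1)).eval x + (derivative (legendre n)).eval x := by
  simp [derivative_legendre_add_two]

theorem integral_legendre_mul_derivative_legendre (n : ℕ) : ∀ m, n ≤ m →
    ∫ x in (-1 : ℝ)..1, (legendre m).eval x * (derivative (legendre n)).eval x = 0 := by
  induction n using Nat.twoStepInduction with
  | zero => simp [legendre_zero]
  | one =>
    intro m hm
    have := integral_legendre_mul_legendre_of_ne (m := m) (n := 0) (by lia)
    simpa [legendre_one, legendre_zero] using this
  | more n ih _ =>
    intro m hm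
    have h : ∀ x : ℝ, (legendre m).eval x * (derivative (legendre (n + 2))).eval x =
        (2 * (n : ℝ) + 3) * ((legendre m).eval x * (legendre (n + 1)).eval x)
          + (legendre m).eval x * (derivative (legendre n)).eval x := fun x => by
      rw [eval_derivative_legendre_add_two]; ring
    simp_rw [h]
    rw [intervalIntegral.integral_add
        ((intervalIntegrable_eval_mul_eval _ _ _ _).const_mul _)
        (intervalIntegrable_eval_mul_eval _ _ _ _), intervalIntegral.integral_const_mul,
      integral_legendre_mul_legendre_of_ne (by lia), ih m (by lia)]
    simp

/-- Integration by parts: the boundary term is 1 - (-1), and the other integral vanishes by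
orthogonality. Expanding the derivative by the recurrence then gives the norm. -/
theorem integral_legendre_mul_derivative_legendre_succ (n : ℕ) :
    ∫ x in (-1 : ℝ)..1, (legendre n).eval x * (derivative (legendre (n + 1))).eval x = 2 := by
  have h := integral_eval_derivative (legendre n * legendre (n + 1)) (-1) 1
  have h' : ∀ x : ℝ, (derivative (legendre n * legendre (n + 1))).eval x =
      (legendre (n + 1)).eval x * (derivative (legendre n)).eval x
      + (legendre n).eval x * (derivative (legendre (n + 1))).eval x := fun x => by
    simp; ring
  simp_rw [h'] at h
  rw [intervalIntegral.integral_add (intervalIntegrable_eval_mul_eval _ _ _ _)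
    (intervalIntegrable_eval_mul_eval _ _ _ _),
    integral_legendre_mul_derivative_legendre n _ n.le_succ] at h
  simp only [zero_add, eval_mul, eval_one_legendre, eval_neg_one_legendre, ← pow_add] at h
  rw [h, show n + (n + 1) = 2 * n + 1 by lia, pow_succ, pow_mul]
  norm_num

theorem integral_legendre_sq (n : ℕ) :
    ∫ x in (-1 : ℝ)..1, (legendre n).eval x * (legendre n).eval x = 2 / (2 * n + 1) := by
  rcases n with _ | n
  · simp [legendre_zero]; norm_num
  have h := integral_legendre_mul_derivative_legendre_succ (n + 1)
  have h' : ∀ x : ℝ, (legendre (n + 1)).eval x * (derivative (legendre (n + 2))).eval x =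
      (2 * (n : ℝ) + 3) * ((legendre (n + 1)).eval x * (legendre (n + 1)).eval x)
        + (legendre (n + 1)).eval x * (derivative (legendre n)).eval x := fun x => by
    rw [eval_derivative_legendre_add_two]; ring
  simp_rw [h'] at h
  rw [intervalIntegral.integral_add
    ((intervalIntegrable_eval_mul_eval _ _ _ _).const_mul _)
    (intervalIntegrable_eval_mul_eval _ _ _ _), intervalIntegral.integral_const_mul,
    integral_legendre_mul_derivative_legendre n _ n.le_succ, add_zero] at h
  rw [eq_div_iff (by positivity)]
  push_cast
  linear_combination h

end Orthogonality

theorem continuous_normLegendre (n : ℕ) : Continuous (normLegendre n) :=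
  continuous_const.mul (legendre n).continuous

theorem integral_normLegendre_mul (m n : ℕ) :
    ∫ x in (-1 : ℝ)..1, normLegendre m x * normLegendre n x = if m = n then 1 else 0 := by
  have h : ∀ x : ℝ, normLegendre m x * normLegendre n x =
      (Real.sqrt ((2 * (m : ℝ) + 1) / 2) * Real.sqrt ((2 * (n : ℝ) + 1) / 2)) *
        ((legendre m).eval x * (legendre n).eval x) := fun x => by
    simp only [normLegendre]; ring
  simp_rw [h]
  rw [intervalIntegral.integral_const_mul]
  split_ifs with hmn
  · subst hmn
    rw [integral_legendre_sq, Real.mul_self_sqrt (by positivity)]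
    field_simp
  · rw [integral_legendre_mul_legendre_of_ne hmn, mul_zero]

theorem normLegendre_mul_normLegendre (n : ℕ) (x y : ℝ) :
    normLegendre n x * normLegendre n y =
      (2 * (n : ℝ) + 1) / 2 * ((legendre n).eval x * (legendre n).eval y) := by
  simp only [normLegendre]
  rw [mul_mul_mul_comm, Real.mul_self_sqrt (by positivity)]

/-! ### Uniform bounds from Sonin's function. -/

section Sonin

open Polynomial

/-- Monotonicity of Sonin's function of a solution of `(1 - x²) f'' - k x f' + l f = 0`. -/
theorem hasDerivAt_sonin {p : ℝ[X]} {k l : ℝ} (hl : l ≠ 0)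
    (h : ∀ x : ℝ, (1 - x ^ 2) * (derivative (derivative p)).eval x
      - k * x * (derivative p).eval x + l * p.eval x = 0) (x : ℝ) :
    HasDerivAt (fun x => p.eval x ^ 2 + (1 - x ^ 2) * (derivative p).eval x ^ 2 / l)
      (2 * (k - 1) / l * x * (derivative p).eval x ^ 2) x := by
  have h1 := p.hasDerivAt x
  have h2 := (derivative p).hasDerivAt x
  have h3 := (h1.pow 2).add ((((hasDerivAt_id x).pow 2).const_sub 1).mul (h2.pow 2) |>.div_const l)
  refine HasDerivAt.congr_deriv h3 ?_
  have := h x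
  simp only [id, Nat.cast_ofNat, Pi.pow_apply]
  field_simp
  simp
  linear_combination (derivative p).eval x * this

theorem continuous_sonin (p : ℝ[X]) (l : ℝ) :
    Continuous (fun x : ℝ => p.eval x ^ 2 + (1 - x ^ 2) * (derivative p).eval x ^ 2 / l) := by
  have := p.continuous
  have := (derivative p).continuous
  fun_prop

theorem sq_eval_le_sonin (p : ℝ[X]) {l : ℝ} (hl : 0 < l) {x : ℝ} (hx : x ∈ Icc (-1 : ℝ) 1) :
    p.eval x ^ 2 ≤ p.eval x ^ 2 + (1 - x ^ 2) * (derivative p).eval x ^ 2 / l := by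
  have : 0 ≤ 1 - x ^ 2 := by nlinarith [hx.1, hx.2]
  have : 0 ≤ (1 - x ^ 2) * (derivative p).eval x ^ 2 / l := by positivity
  linarith

theorem abs_eval_legendre_le_one (n : ℕ) {x : ℝ} (hx : x ∈ Icc (-1 : ℝ) 1) :
    |(legendre n).eval x| ≤ 1 := by
  rcases Nat.eq_zero_or_pos n with rfl | hn
  · simp [legendre_zero]
  have hl : (0 : ℝ) < n * (n + 1) := by positivity
  -- For k = 2 the derivative has the sign of x, so Sonin's function peaks at ±1, where it equals 1.
  have hd := hasDerivAt_sonin (p := legendre n) (k := 2) hl.ne' fun x => by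
    simpa using congrArg (eval x) (legendre_ode n)
  have hc := continuous_sonin (legendre n) (n * (n + 1))
  rw [abs_le_one_iff_mul_self_le_one, ← sq]
  refine (sq_eval_le_sonin _ hl hx).trans ?_
  rcases le_total 0 x with h0 | h0
  · have hm : MonotoneOn (fun x : ℝ => (legendre n).eval x ^ 2
        + (1 - x ^ 2) * (derivative (legendre n)).eval x ^ 2 / (n * (n + 1))) (Ici 0) :=
      monotoneOn_of_hasDerivWithinAt_nonneg (convex_Ici 0) hc.continuousOn
        (fun x _ => (hd x).hasDerivWithinAt) fun x hx => by
          rw [interior_Ici] at hx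
          have : (0 : ℝ) < x := hx
          norm_num
          positivity
    simpa [eval_one_legendre] using hm (mem_Ici.2 h0) (mem_Ici.2 zero_le_one) hx.2
  · have hm : AntitoneOn (fun x : ℝ => (legendre n).eval x ^ 2
        + (1 - x ^ 2) * (derivative (legendre n)).eval x ^ 2 / (n * (n + 1))) (Iic 0) :=
      antitoneOn_of_hasDerivWithinAt_nonpos (convex_Iic 0) hc.continuousOn
        (fun x _ => (hd x).hasDerivWithinAt) fun x hx => by
          rw [interior_Iic] at hx
          have : x < 0 := hx
          norm_num
          exact mul_nonpos_of_nonpos_of_nonneg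
            (mul_nonpos_of_nonneg_of_nonpos (by positivity) this.le) (by positivity)
    have := hm (mem_Iic.2 (by norm_num : (-1 : ℝ) ≤ 0)) (mem_Iic.2 h0) hx.1
    simpa [eval_neg_one_legendre, ← pow_mul, mul_comm n 2] using this

/-- The difference of two consecutive even Legendre polynomials is largest at the origin. -/
theorem abs_eval_legendre_sub_le (n : ℕ) {x : ℝ} (hx : x ∈ Icc (-1 : ℝ) 1) :
    |(legendre (2 * (n + 1))).eval x - (legendre (2 * n)).eval x| ≤
      |(legendre (2 * (n + 1))).eval 0 - (legendre (2 * n)).eval 0| := by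
  set g : ℝ[X] := legendre (2 * n + 2) - legendre (2 * n) with hg
  have hg1 : derivative g = (2 * ((2 * n : ℕ) : ℝ[X]) + 3) * legendre (2 * n + 1) := by
    rw [hg, derivative_sub, derivative_legendre_add_two]; ring
  have hl : (0 : ℝ) < (2 * n + 1) * (2 * n + 2) := by positivity
  -- `g` satisfies (1 - x²) g'' + l g = 0 without first-order term. With k = 0 the monotonicity is
  -- reversed, so the peak is at the origin, where g' = 0.
  have hd := hasDerivAt_sonin (p := g) (k := 0) hl.ne' fun x => by
    have := congrArg (eval x) (one_sub_X_sq_mul_derivative_legendre (2 * n))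
    rw [hg1]
    simp [hg] at this ⊢
    linear_combination this
  have hc := continuous_sonin g ((2 * n + 1) * (2 * n + 2))
  have h00 : (derivative g).eval 0 = 0 := by simp [hg1, eval_zero_legendre_odd]
  have key : g.eval x ^ 2 ≤ g.eval 0 ^ 2 := by
    refine (sq_eval_le_sonin _ hl hx).trans ?_
    rcases le_total 0 x with h0 | h0
    · have hm : AntitoneOn (fun x : ℝ => g.eval x ^ 2
          + (1 - x ^ 2) * (derivative g).eval x ^ 2 / ((2 * n + 1) * (2 * n + 2))) (Ici 0) :=
        antitoneOn_of_hasDerivWithinAt_nonpos (convex_Ici 0) hc.continuousOn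
          (fun x _ => (hd x).hasDerivWithinAt) fun x hx => by
            rw [interior_Ici] at hx
            have : (0 : ℝ) < x := hx
            have : 0 ≤ 2 / ((2 * (n : ℝ) + 1) * (2 * n + 2)) * x * (derivative g).eval x ^ 2 := by
              positivity
            calc _ = -(2 / ((2 * (n : ℝ) + 1) * (2 * n + 2)) * x * (derivative g).eval x ^ 2) := by
                  ring
              _ ≤ 0 := by linarith
      simpa [h00] using hm (mem_Ici.2 le_rfl) (mem_Ici.2 h0) h0
    · have hm : MonotoneOn (fun x : ℝ => g.eval x ^ 2
          + (1 - x ^ 2) * (derivative g).eval x ^ 2 / ((2 * n + 1) * (2 * n + 2))) (Iic 0) :=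
        monotoneOn_of_hasDerivWithinAt_nonneg (convex_Iic 0) hc.continuousOn
          (fun x _ => (hd x).hasDerivWithinAt) fun x hx => by
            rw [interior_Iic] at hx
            have : 0 < -x := neg_pos.2 hx
            calc 0 ≤ 2 / ((2 * (n : ℝ) + 1) * (2 * n + 2)) * (-x) * (derivative g).eval x ^ 2 := by
                  positivity
              _ = _ := by ring
      simpa [h00] using hm (mem_Iic.2 h0) (mem_Iic.2 le_rfl) h0
  have := sq_le_sq.1 key
  rw [hg, eval_sub, eval_sub] at this
  exact this

end Sonin

/-! ### Uniform convergence and its consequences for Mercer's expansions. -/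

section Uniform

/-- An alternating series of functions whose terms tend uniformly to zero and have uniformly
bounded total variation converges uniformly. -/
theorem exists_tendstoUniformlyOn_alternating {α : Type*} {s : Set α} {b : ℕ → α → ℝ}
    {e w : ℕ → ℝ} (he : ∀ n, 0 ≤ e n) (hbe : ∀ n, ∀ p ∈ s, |b n p - b (n + 1) p| ≤ e n - e (n + 1))
    (hbw : ∀ n, ∀ p ∈ s, |b n p| ≤ w n) (hw : Tendsto w atTop (𝓝 0)) :
    ∃ f : α → ℝ, TendstoUniformlyOn
      (fun (N : ℕ) (p : α) => ∑ n ∈ Finset.range N, (-1 : ℝ) ^ n * b n p) f atTop s := by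
  rcases s.eq_empty_or_nonempty with rfl | ⟨p₀, hp₀⟩
  · exact ⟨0, tendstoUniformlyOn_empty⟩
  have hsum : Summable fun n => e n - e (n + 1) := by
    refine summable_of_sum_range_le (c := e 0)
      (fun n => (abs_nonneg _).trans (hbe n p₀ hp₀)) fun n => ?_
    rw [Finset.sum_range_sub']
    linarith [he n]
  have h1 := tendstoUniformlyOn_tsum_nat (s := s)
    (f := fun n p => (-1 : ℝ) ^ n * (b n p - b (n + 1) p)) hsum fun n p hp => by
      simpa [abs_mul] using hbe n p hp
  have h2 : TendstoUniformlyOn (fun (n : ℕ) (p : α) => (-1 : ℝ) ^ n * b n p) 0 atTop s := by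
    rw [Metric.tendstoUniformlyOn_iff]
    intro ε hε
    filter_upwards [hw.eventually (gt_mem_nhds hε)] with n hn p hp
    simpa [Real.dist_eq, abs_mul] using (hbw n p hp).trans_lt hn
  -- Summation by parts: twice the alternating sum is a boundary part plus a series of differences,
  -- which the M-test handles.
  have h3 : ∀ N p, ∑ n ∈ Finset.range N, (-1 : ℝ) ^ n * b n p =
      (b 0 p + ((∑ n ∈ Finset.range N, (-1 : ℝ) ^ n * (b n p - b (n + 1) p))
        - (-1 : ℝ) ^ N * b N p)) / 2 := by
    intro N p
    induction N with
    | zero => simp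
    | succ N ih => rw [Finset.sum_range_succ, Finset.sum_range_succ, ih, pow_succ]; ring
  refine ⟨fun p => (b 0 p + ((∑' n, (-1 : ℝ) ^ n * (b n p - b (n + 1) p)) - 0)) / 2, ?_⟩
  have h4 := h1.sub h2
  rw [Metric.tendstoUniformlyOn_iff] at h4 ⊢
  intro ε hε
  filter_upwards [h4 ε hε] with N hN p hp
  have := hN p hp
  rw [Real.dist_eq] at this ⊢
  simp only [Pi.sub_apply, Pi.zero_apply] at this
  rw [h3, ← sub_div, add_sub_add_left_eq_sub, abs_div, abs_two]
  linarith [abs_nonneg ((∑' n, (-1 : ℝ) ^ n * (b n p - b (n + 1) p)) - 0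
    - ((∑ n ∈ Finset.range N, (-1 : ℝ) ^ n * (b n p - b (n + 1) p)) - (-1 : ℝ) ^ N * b N p))]

theorem tendsto_integral_mul_of_tendstoUniformlyOn {a b : ℝ} (hab : a ≤ b) {F : ℕ → ℝ → ℝ}
    {f g : ℝ → ℝ} (hF : ∀ N, ContinuousOn (F N) (Icc a b)) (hg : ContinuousOn g (Icc a b))
    (h : TendstoUniformlyOn F f atTop (Icc a b)) :
    Tendsto (fun N => ∫ x in a..b, F N x * g x) atTop (𝓝 (∫ x in a..b, f x * g x)) := by
  refine TendstoUniformlyOn.tendsto_intervalIntegral_of_continuousOn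
    (Eventually.of_forall fun N => ?_) ?_
  · rw [uIcc_of_le hab]; exact (hF N).mul hg
  · rw [uIcc_of_le hab]
    obtain ⟨C, hC⟩ := isCompact_Icc.exists_bound_of_continuousOn hg
    rw [Metric.tendstoUniformlyOn_iff] at h ⊢
    intro ε hε
    have hC' : 0 < |C| + 1 := by positivity
    filter_upwards [h (ε / (|C| + 1)) (by positivity)] with N hN x hx
    have h1 := hN x hx
    have h2 := hC x hx
    rw [Real.dist_eq] at h1 ⊢
    rw [← sub_mul, abs_mul]
    rw [lt_div_iff₀ hC'] at h1
    rw [Real.norm_eq_abs] at h2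
    have h3 : |f x - F N x| * |g x| ≤ |f x - F N x| * (|C| + 1) := by
      gcongr
      linarith [le_abs_self C]
    linarith

/-- By orthonormality the integral against a partial sum equals c n as soon as N > n; uniform
convergence passes to the limit. -/
theorem tendsto_integral_sum_mul {a b : ℝ} (hab : a ≤ b) {v : ℕ → ℝ → ℝ}
    (hv : IsContOrthonormal a b v) {f : ℝ → ℝ} (c : ℕ → ℝ)
    (h : TendstoUniformlyOn (fun (N : ℕ) y => ∑ n ∈ Finset.range N, c n * v n y) f atTop (Icc a b))
    (n : ℕ) : ∫ y in a..b, f y * v n y = c n := by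
  have h1 := tendsto_integral_mul_of_tendstoUniformlyOn hab
    (F := fun N y => ∑ n ∈ Finset.range N, c n * v n y)
    (fun N => continuousOn_finsetSum _ fun k _ => continuousOn_const.mul (hv.continuousOn k))
    (hv.continuousOn n) h
  refine tendsto_nhds_unique h1 (tendsto_const_nhds.congr' ?_)
  filter_upwards [eventually_gt_atTop n] with N hN
  have h2 : ∀ y, (∑ k ∈ Finset.range N, c k * v k y) * v n y =
      ∑ k ∈ Finset.range N, c k * (v k y * v n y) := fun y => by
    rw [Finset.sum_mul]; exact Finset.sum_congr rfl fun k _ => by ring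
  rw [intervalIntegral.integral_congr fun y _ => h2 y, intervalIntegral.integral_finsetSum]
  · simp_rw [intervalIntegral.integral_const_mul, hv.orthonormal]
    simp [hN]
  · intro k _
    refine ContinuousOn.intervalIntegrable ?_
    rw [uIcc_of_le hab]
    exact continuousOn_const.mul ((hv.continuousOn k).mul (hv.continuousOn n))

theorem IsMercerExpansion.of_tendstoUniformlyOn {a b : ℝ} (hab : a ≤ b) {K : ℝ → ℝ → ℝ}
    {σ : ℕ → ℝ} {u v : ℕ → ℝ → ℝ} (hpos : ∀ n, 0 < σ n) (hanti : Antitone σ)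
    (hu : IsContOrthonormal a b u) (hv : IsContOrthonormal a b v)
    (h : TendstoUniformlyOn (fun (N : ℕ) (p : ℝ × ℝ) =>
      ∑ n ∈ Finset.range N, σ n * u n p.1 * v n p.2) (fun p => K p.1 p.2) atTop
      (Icc a b ×ˢ Icc a b)) : IsMercerExpansion a b a b K σ u v where
  pos := hpos
  antitone := hanti
  left := hu
  right := hv
  integral_left n x hx := by
    refine tendsto_integral_sum_mul hab hv (fun n => σ n * u n x) ?_ n
    exact (h.comp (fun y => (x, y))).mono fun y hy => ⟨hx, hy⟩
  integral_right n y hy := by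
    refine tendsto_integral_sum_mul hab hu (fun n => σ n * v n y) ?_ n
    refine ((h.comp (fun x => (x, y))).mono fun x hx => ⟨hx, hy⟩).congr
      (Eventually.of_forall fun N x _ => Finset.sum_congr rfl fun k _ => ?_)
    ring
  tendsto_L2 := by
    rw [Metric.tendsto_atTop']
    intro ε hε
    rw [Metric.tendstoUniformlyOn_iff] at h
    set D := (b - a) ^ 2 + 1 with hD
    have hD0 : 0 < D := by positivity
    -- Chosen so that the double integral is at most (ε/2)(b - a)²/D ≤ ε/2; the summand 1 in `D`
    -- keeps it positive.
    obtain ⟨N₀, hN₀⟩ := eventually_atTop.1 (h (Real.sqrt (ε / (2 * D))) (by positivity))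
    refine ⟨N₀, fun N hN => ?_⟩
    have hsub : uIoc a b ⊆ Icc a b := by rw [uIoc_of_le hab]; exact Ioc_subset_Icc_self
    have h1 : ∀ x ∈ uIoc a b, ‖∫ y in a..b,
        (K x y - ∑ n ∈ Finset.range N, σ n * u n x * v n y) ^ 2‖ ≤ ε / (2 * D) * |b - a| := by
      intro x hx
      refine intervalIntegral.norm_integral_le_of_norm_le_const fun y hy => ?_
      have h2 := (hN₀ N hN.le (x, y) ⟨hsub hx, hsub hy⟩).le
      rw [Real.dist_eq] at h2
      rw [norm_pow, Real.norm_eq_abs]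
      calc _ ≤ Real.sqrt (ε / (2 * D)) ^ 2 := by gcongr
        _ = _ := Real.sq_sqrt (by positivity)
    have h3 := intervalIntegral.norm_integral_le_of_norm_le_const h1
    rw [dist_zero_right]
    refine h3.trans_lt ?_
    have h4 : ε / (2 * D) * |b - a| * |b - a| = ε / 2 * ((b - a) ^ 2 / D) := by
      rw [mul_assoc, abs_mul_abs_self]
      field_simp
    have h5 : (b - a) ^ 2 / D ≤ 1 := by
      rw [div_le_one hD0]; linarith
    rw [h4]
    nlinarith

theorem convergesPointwise_of_tendstoUniformlyOn {a b : ℝ} {K : ℝ → ℝ → ℝ}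
    {σ : ℕ → ℝ} {u v : ℕ → ℝ → ℝ}
    (h : TendstoUniformlyOn (fun (N : ℕ) (p : ℝ × ℝ) =>
      ∑ n ∈ Finset.range N, σ n * u n p.1 * v n p.2) (fun p => K p.1 p.2) atTop
      (Icc a b ×ˢ Icc a b)) : ConvergesPointwise a b a b K σ u v :=
  fun x hx y hy => h.tendsto_at (x := (x, y)) ⟨hx, hy⟩

end Uniform

/-! ### Transport along an increasing affine map. -/

section Affine

variable {c d a b : ℝ}

/-- The factor √c absorbs the Jacobian; two such factors account for the c in front of the
transported kernel, so σ is unchanged. -/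
theorem IsContOrthonormal.comp_affine {a' b' : ℝ} (hc : 0 < c) (ha : c * a + d = a')
    (hb : c * b + d = b') {u : ℕ → ℝ → ℝ} (hu : IsContOrthonormal a' b' u) :
    IsContOrthonormal a b (fun n x => Real.sqrt c * u n (c * x + d)) where
  continuousOn n := by
    refine continuousOn_const.mul ((hu.continuousOn n).comp (by fun_prop) fun x hx => ?_)
    rw [← ha, ← hb]
    exact ⟨by gcongr; exact hx.1, by gcongr; exact hx.2⟩
  orthonormal m n := by
    have h : ∀ x, Real.sqrt c * u m (c * x + d) * (Real.sqrt c * u n (c * x + d)) =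
        c * (u m (c * x + d) * u n (c * x + d)) := fun x => by
      rw [mul_mul_mul_comm, Real.mul_self_sqrt hc.le]
    simp_rw [h]
    rw [intervalIntegral.integral_const_mul, intervalIntegral.integral_comp_mul_add
      (fun t => u m t * u n t) hc.ne', ha, hb, hu.orthonormal, smul_eq_mul, mul_inv_cancel_left₀ hc.ne']

theorem IsPosDef.of_comp_affine {a' b' : ℝ} (hc : 0 < c) (ha : c * a + d = a')
    (hb : c * b + d = b') {K : ℝ → ℝ → ℝ}
    (h : IsPosDef a b (fun x y => c * K (c * x + d) (c * y + d))) : IsPosDef a' b' K := by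
  intro N k x hx
  have h1 := h N k (fun i => (x i - d) / c) fun i => by
    rw [mem_Icc, le_div_iff₀ hc, div_le_iff₀ hc]
    constructor <;> linarith [(hx i).1, (hx i).2]
  have h2 : ∀ t : ℝ, c * ((t - d) / c) + d = t := fun t => by field_simp; ring
  simp only [h2, mul_left_comm _ c, ← Finset.mul_sum] at h1
  exact (mul_nonneg_iff_of_pos_left hc).1 h1

theorem IsContSymmIndefinite.comp_affine {a' b' : ℝ} (hc : 0 < c) (ha : c * a + d = a')
    (hb : c * b + d = b') {K : ℝ → ℝ → ℝ} (h : IsContSymmIndefinite a' b' K) :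
    IsContSymmIndefinite a b (fun x y => c * K (c * x + d) (c * y + d)) := by
  have hmaps : ∀ x ∈ Icc a b, c * x + d ∈ Icc a' b' := fun x hx => by
    rw [← ha, ← hb]
    exact ⟨by gcongr; exact hx.1, by gcongr; exact hx.2⟩
  refine ⟨?_, fun x hx y hy => by rw [h.symm _ (hmaps x hx) _ (hmaps y hy)], fun hK => ?_,
    fun hK => ?_⟩
  · exact continuousOn_const.mul (h.continuousOn.comp
      (f := fun p : ℝ × ℝ => (c * p.1 + d, c * p.2 + d)) (by fun_prop)
      fun p hp => ⟨hmaps _ hp.1, hmaps _ hp.2⟩)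
  · exact h.indefinite.1 (hK.of_comp_affine hc ha hb)
  · simp only [← mul_neg] at hK
    exact h.indefinite.2 (IsPosDef.of_comp_affine (K := fun x y => -K x y) hc ha hb hK)

theorem tendstoUniformlyOn_comp_affine {a' b' : ℝ} (hc : 0 < c) (ha : c * a + d = a')
    (hb : c * b + d = b') {K : ℝ → ℝ → ℝ} {σ : ℕ → ℝ} {u v : ℕ → ℝ → ℝ}
    (h : TendstoUniformlyOn (fun (N : ℕ) (p : ℝ × ℝ) =>
      ∑ n ∈ Finset.range N, σ n * u n p.1 * v n p.2) (fun p => K p.1 p.2) atTop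
      (Icc a' b' ×ˢ Icc a' b')) :
    TendstoUniformlyOn (fun (N : ℕ) (p : ℝ × ℝ) => ∑ n ∈ Finset.range N,
      σ n * (Real.sqrt c * u n (c * p.1 + d)) * (Real.sqrt c * v n (c * p.2 + d)))
      (fun p => c * K (c * p.1 + d) (c * p.2 + d)) atTop (Icc a b ×ˢ Icc a b) := by
  have hmaps : ∀ x ∈ Icc a b, c * x + d ∈ Icc a' b' := fun x hx => by
    rw [← ha, ← hb]
    exact ⟨by gcongr; exact hx.1, by gcongr; exact hx.2⟩
  rw [Metric.tendstoUniformlyOn_iff] at h ⊢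
  intro ε hε
  filter_upwards [h (ε / c) (by positivity)] with N hN p hp
  have h1 := hN (c * p.1 + d, c * p.2 + d) ⟨hmaps _ hp.1, hmaps _ hp.2⟩
  have h2 : ∀ n, σ n * (Real.sqrt c * u n (c * p.1 + d)) * (Real.sqrt c * v n (c * p.2 + d)) =
      c * (σ n * u n (c * p.1 + d) * v n (c * p.2 + d)) := fun n => by
    linear_combination σ n * u n (c * p.1 + d) * v n (c * p.2 + d) * Real.mul_self_sqrt hc.le
  simp_rw [h2, ← Finset.mul_sum]
  rw [Real.dist_eq] at h1 ⊢
  rwa [← mul_sub, abs_mul, abs_of_pos hc, mul_comm, ← lt_div_iff₀ hc]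

theorem ConvergesAbsolutely.of_comp_affine {a' b' : ℝ} (hc : 0 < c) (ha : c * a + d = a')
    (hb : c * b + d = b') {σ : ℕ → ℝ} {u v : ℕ → ℝ → ℝ}
    (h : ConvergesAbsolutely a b a b σ (fun n x => Real.sqrt c * u n (c * x + d))
      (fun n x => Real.sqrt c * v n (c * x + d))) : ConvergesAbsolutely a' b' a' b' σ u v := by
  have hmaps : ∀ t ∈ Icc a' b', (t - d) / c ∈ Icc a b := fun t ht => by
    rw [mem_Icc, le_div_iff₀ hc, div_le_iff₀ hc]
    constructor <;> linarith [ht.1, ht.2]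
  intro x hx y hy
  have h1 := h _ (hmaps x hx) _ (hmaps y hy)
  have h2 : ∀ t : ℝ, c * ((t - d) / c) + d = t := fun t => by field_simp; ring
  have h3 : ∀ n, |σ n * (Real.sqrt c * u n x) * (Real.sqrt c * v n y)| =
      c * |σ n * u n x * v n y| := fun n => by
    rw [← abs_of_pos hc, ← abs_mul, abs_of_pos hc]
    congr 1
    linear_combination σ n * u n x * v n y * Real.mul_self_sqrt hc.le
  simp only [h2, h3] at h1
  exact (summable_mul_left_iff hc.ne').1 h1

end Affine

/-! ### Estimates for the terms of the series. -/

/-- The absolute value of the Legendre polynomial of degree `2 * n` at the origin. -/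
noncomputable def centralRatio (n : ℕ) : ℝ := n.centralBinom / 4 ^ n

theorem centralRatio_nonneg (n : ℕ) : 0 ≤ centralRatio n := by
  unfold centralRatio; positivity

theorem centralRatio_zero : centralRatio 0 = 1 := by simp [centralRatio]

theorem centralRatio_succ (n : ℕ) :
    centralRatio (n + 1) = centralRatio n * ((2 * n + 1) / (2 * n + 2)) := by
  have h : ((n : ℝ) + 1) * (n + 1).centralBinom = 2 * (2 * n + 1) * n.centralBinom := by
    exact_mod_cast Nat.succ_mul_centralBinom_succ n
  rw [centralRatio, centralRatio, pow_succ]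
  field_simp
  linear_combination 2 * h

/-- Turns the ratio divided by n into a telescoping difference, so no asymptotics of central
binomials are needed. -/
theorem centralRatio_sub_succ (n : ℕ) :
    (2 * n + 2) * (centralRatio n - centralRatio (n + 1)) = centralRatio n := by
  rw [centralRatio_succ]
  field_simp
  ring

theorem antitone_centralRatio : Antitone centralRatio :=
  antitone_nat_of_succ_le fun n => by
    have h := centralRatio_sub_succ n
    have h0 := centralRatio_nonneg n
    rw [← h] at h0
    linarith [nonneg_of_mul_nonneg_right h0 (by positivity)]

theorem eval_zero_legendre_even_eq (n : ℕ) :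
    (legendre (2 * n)).eval 0 = (-1) ^ n * centralRatio n :=
  eval_zero_legendre_even n

theorem abs_eval_legendre_even_sub_le (n : ℕ) {x : ℝ} (hx : x ∈ Icc (-1 : ℝ) 1) :
    |(legendre (2 * n)).eval x - (legendre (2 * (n + 1))).eval x| ≤ 2 * centralRatio n := by
  rw [abs_sub_comm]
  refine (abs_eval_legendre_sub_le n hx).trans ?_
  rw [eval_zero_legendre_even_eq, eval_zero_legendre_even_eq, pow_succ]
  -- At the origin the two values have opposite signs, so their sizes add.
  have h : (-1 : ℝ) ^ n * -1 * centralRatio (n + 1) - (-1) ^ n * centralRatio n =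
      (-1) ^ (n + 1) * (centralRatio (n + 1) + centralRatio n) := by ring
  rw [h, abs_mul, abs_pow, abs_neg, abs_one, one_pow, one_mul,
    abs_of_nonneg (add_nonneg (centralRatio_nonneg _) (centralRatio_nonneg _))]
  linarith [antitone_centralRatio n.le_succ]

/-- The coefficient of `P₂ₘ(x) P₂ₘ(y)`, `m = n + 1`, in the kernel, without its
alternating sign. -/
noncomputable def weight (n : ℕ) : ℝ := (4 * n + 5) / (2 * (n + 1) ^ 2)

theorem weight_pos (n : ℕ) : 0 < weight n := by unfold weight; positivity

theorem antitone_weight : Antitone weight :=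
  antitone_nat_of_succ_le fun n => by
    unfold weight
    rw [div_le_div_iff₀ (by positivity) (by positivity)]
    push_cast
    nlinarith [(n.cast_nonneg : (0 : ℝ) ≤ n), mul_nonneg (n.cast_nonneg : (0 : ℝ) ≤ n)
      (n.cast_nonneg : (0 : ℝ) ≤ n), sq_nonneg ((n : ℝ))]

theorem weight_le (n : ℕ) : weight n ≤ 5 / 2 * (1 / ((n : ℝ) + 1)) := by
  have : (0 : ℝ) ≤ n := n.cast_nonneg
  rw [weight, ← mul_div_assoc, div_le_div_iff₀ (by positivity) (by positivity)]
  nlinarith [mul_nonneg this this]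

theorem le_weight (n : ℕ) : 1 / ((n : ℝ) + 1) ≤ weight n := by
  have : (0 : ℝ) ≤ n := n.cast_nonneg
  rw [weight, div_le_div_iff₀ (by positivity) (by positivity)]
  nlinarith [mul_nonneg this this]

theorem tendsto_weight : Tendsto weight atTop (𝓝 0) :=
  squeeze_zero (fun n => (weight_pos n).le) weight_le <| by
    simpa using (tendsto_one_div_add_atTop_nhds_zero_nat (𝕜 := ℝ)).const_mul (5 / 2)

theorem not_summable_weight : ¬ Summable weight := fun h => by
  have h1 : Summable fun n : ℕ => 1 / ((n : ℝ) + 1) :=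
    Summable.of_nonneg_of_le (fun n => by positivity) le_weight h
  refine Real.not_summable_one_div_natCast ((summable_nat_add_iff 1).1 ?_)
  simpa using h1

/-- The `n`-th term of the series of the kernel, without its alternating sign. -/
noncomputable def legendreTerm (n : ℕ) (p : ℝ × ℝ) : ℝ :=
  weight n * ((legendre (2 * (n + 1))).eval p.1 * (legendre (2 * (n + 1))).eval p.2)

theorem continuous_legendreTerm (n : ℕ) : Continuous (legendreTerm n) :=
  continuous_const.mul (((legendre _).continuous.comp continuous_fst).mul
    ((legendre _).continuous.comp continuous_snd))

theorem abs_legendreTerm_le (n : ℕ) {p : ℝ × ℝ} (hp : p ∈ Icc (-1 : ℝ) 1 ×ˢ Icc (-1 : ℝ) 1) :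
    |legendreTerm n p| ≤ weight n := by
  rw [legendreTerm, abs_mul, abs_mul, abs_of_pos (weight_pos n)]
  exact mul_le_of_le_one_right (weight_pos n).le (mul_le_one₀ (abs_eval_legendre_le_one _ hp.1)
    (abs_nonneg _) (abs_eval_legendre_le_one _ hp.2))

theorem weight_mul_centralRatio_le (n : ℕ) :
    weight n * centralRatio (n + 1) ≤ 10 * (centralRatio (n + 1) - centralRatio (n + 2)) := by
  have h := centralRatio_sub_succ (n + 1)
  have h1 : 0 ≤ centralRatio (n + 1) - centralRatio (n + 2) :=
    sub_nonneg.2 (antitone_centralRatio (Nat.le_succ _))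
  -- Equality holds at n = 0.
  have h2 : weight n * (2 * ((n + 1 : ℕ) : ℝ) + 2) ≤ 10 := by
    have : (0 : ℝ) ≤ n := n.cast_nonneg
    rw [weight, div_mul_eq_mul_div, div_le_iff₀ (by positivity)]
    push_cast
    nlinarith [mul_nonneg this this]
  calc weight n * centralRatio (n + 1) =
        weight n * (2 * ((n + 1 : ℕ) : ℝ) + 2) * (centralRatio (n + 1) - centralRatio (n + 2)) := by
        linear_combination -weight n * h
    _ ≤ _ := by gcongr

/-- The variation splits into that of the weight and that of the product of polynomials; the latter
is at most 4 ratios, and 40 = 4 · 10 by `weight_mul_centralRatio_le`. -/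
theorem abs_legendreTerm_sub_le (n : ℕ) {p : ℝ × ℝ} (hp : p ∈ Icc (-1 : ℝ) 1 ×ˢ Icc (-1 : ℝ) 1) :
    |legendreTerm n p - legendreTerm (n + 1) p| ≤
      (weight n + 40 * centralRatio (n + 1)) - (weight (n + 1) + 40 * centralRatio (n + 2)) := by
  have hx := abs_eval_legendre_even_sub_le (n + 1) hp.1
  have hy := abs_eval_legendre_even_sub_le (n + 1) hp.2
  have hx1 := abs_eval_legendre_le_one (2 * (n + 1 + 1)) hp.1
  have hy0 := abs_eval_legendre_le_one (2 * (n + 1)) hp.2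
  have hy1 := abs_eval_legendre_le_one (2 * (n + 1 + 1)) hp.2
  simp only [legendreTerm]
  generalize (legendre (2 * (n + 1))).eval p.1 = x0 at *
  generalize (legendre (2 * (n + 1))).eval p.2 = y0 at *
  generalize (legendre (2 * (n + 1 + 1))).eval p.1 = x1 at *
  generalize (legendre (2 * (n + 1 + 1))).eval p.2 = y1 at *
  have hw := weight_mul_centralRatio_le n
  have hw1 := antitone_weight n.le_succ
  have hw0 := (weight_pos n).le
  have h : weight n * (x0 * y0) - weight (n + 1) * (x1 * y1) =
      (weight n - weight (n + 1)) * (x1 * y1) + weight n * ((x0 - x1) * y0 + x1 * (y0 - y1)) := by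
    ring
  have h1 : |(weight n - weight (n + 1)) * (x1 * y1)| ≤ weight n - weight (n + 1) := by
    rw [abs_mul, abs_mul, abs_of_nonneg (sub_nonneg.2 hw1)]
    exact mul_le_of_le_one_right (sub_nonneg.2 hw1) (mul_le_one₀ hx1 (abs_nonneg _) hy1)
  have h2 : |(x0 - x1) * y0 + x1 * (y0 - y1)| ≤ 4 * centralRatio (n + 1) := by
    refine (abs_add_le _ _).trans ?_
    rw [abs_mul, abs_mul]
    have := mul_le_of_le_one_right (abs_nonneg (x0 - x1)) hy0
    have := mul_le_of_le_one_left (abs_nonneg (y0 - y1)) hx1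
    linarith
  have h3 : |weight n * ((x0 - x1) * y0 + x1 * (y0 - y1))| ≤
      weight n * (4 * centralRatio (n + 1)) := by
    rw [abs_mul, abs_of_nonneg hw0]
    gcongr
  rw [h]
  refine (abs_add_le _ _).trans ?_
  linarith

/-! ### The kernel on [-1,1] and its indefiniteness. -/

theorem exists_tendstoUniformlyOn_legendreTerm : ∃ K : ℝ → ℝ → ℝ, TendstoUniformlyOn
    (fun (N : ℕ) (p : ℝ × ℝ) => ∑ n ∈ Finset.range N, (-1 : ℝ) ^ (n + 1) * legendreTerm n p)
    (fun p => K p.1 p.2) atTop (Icc (-1 : ℝ) 1 ×ˢ Icc (-1 : ℝ) 1) := by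
  obtain ⟨f, hf⟩ := exists_tendstoUniformlyOn_alternating
    (b := legendreTerm) (s := Icc (-1 : ℝ) 1 ×ˢ Icc (-1 : ℝ) 1)
    (e := fun n => weight n + 40 * centralRatio (n + 1))
    (fun n => add_nonneg (weight_pos n).le (mul_nonneg (by norm_num) (centralRatio_nonneg _)))
    (fun n p hp => abs_legendreTerm_sub_le n hp) (fun n p hp => abs_legendreTerm_le n hp)
    tendsto_weight
  refine ⟨fun x y => -f (x, y), hf.neg.congr (Eventually.of_forall fun N p _ => ?_)⟩
  simp only [Pi.neg_apply, ← Finset.sum_neg_distrib]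
  exact Finset.sum_congr rfl fun n _ => by ring

theorem legendreTerm_one_one (n : ℕ) : legendreTerm n (1, 1) = weight n := by
  simp [legendreTerm, eval_one_legendre]

theorem legendreTerm_zero_zero (n : ℕ) :
    legendreTerm n (0, 0) = weight n * centralRatio (n + 1) ^ 2 := by
  simp only [legendreTerm, eval_zero_legendre_even_eq]
  calc _ = (-1 * -1 : ℝ) ^ (n + 1) * (weight n * centralRatio (n + 1) ^ 2) := by
        rw [mul_pow]; ring
    _ = _ := by norm_num

theorem legendreTerm_zero_one (n : ℕ) :
    (-1) ^ (n + 1) * legendreTerm n (0, 1) = weight n * centralRatio (n + 1) := by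
  simp only [legendreTerm, eval_zero_legendre_even_eq, eval_one_legendre]
  calc _ = (-1 * -1 : ℝ) ^ (n + 1) * (weight n * centralRatio (n + 1)) := by rw [mul_pow]; ring
    _ = _ := by norm_num

/-- On the diagonal points used the series alternates with decreasing terms, so partial sums bound
it; at (0,1) the signs of P_{2n+2}(0) cancel the alternation and all terms are nonnegative. -/
theorem isContSymmIndefinite_of_tendstoUniformlyOn {K : ℝ → ℝ → ℝ} (h : TendstoUniformlyOn
    (fun (N : ℕ) (p : ℝ × ℝ) => ∑ n ∈ Finset.range N, (-1 : ℝ) ^ (n + 1) * legendreTerm n p)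
    (fun p => K p.1 p.2) atTop (Icc (-1 : ℝ) 1 ×ˢ Icc (-1 : ℝ) 1)) :
    IsContSymmIndefinite (-1) 1 K := by
  have hm0 : (0 : ℝ) ∈ Icc (-1 : ℝ) 1 := by norm_num
  have hm1 : (1 : ℝ) ∈ Icc (-1 : ℝ) 1 := by norm_num
  have hneg : ∀ x ∈ Icc (-1 : ℝ) 1, ∀ y ∈ Icc (-1 : ℝ) 1, Tendsto (fun N : ℕ =>
      ∑ n ∈ Finset.range N, (-1 : ℝ) ^ n * legendreTerm n (x, y)) atTop (𝓝 (-K x y)) := by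
    intro x hx y hy
    refine (h.tendsto_at (x := (x, y)) ⟨hx, hy⟩).neg.congr fun N => ?_
    rw [← Finset.sum_neg_distrib]
    exact Finset.sum_congr rfl fun n _ => by ring
  have hsymm : ∀ x ∈ Icc (-1 : ℝ) 1, ∀ y ∈ Icc (-1 : ℝ) 1, K x y = K y x := by
    intro x hx y hy
    refine tendsto_nhds_unique (h.tendsto_at (x := (x, y)) ⟨hx, hy⟩)
      ((h.tendsto_at (x := (y, x)) ⟨hy, hx⟩).congr fun N => ?_)
    exact Finset.sum_congr rfl fun n _ => by simp only [legendreTerm]; ring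
  have h11 := hneg 1 hm1 1 hm1
  simp only [legendreTerm_one_one] at h11
  have h00 := hneg 0 hm0 0 hm0
  simp only [legendreTerm_zero_zero] at h00
  have h01 := h.tendsto_at (x := ((0 : ℝ), (1 : ℝ))) ⟨hm0, hm1⟩
  simp only [legendreTerm_zero_one] at h01
  have hw0 : weight 0 = 5 / 2 := by norm_num [weight]
  have hw1 : weight 1 = 9 / 8 := by norm_num [weight]
  have hc1 : centralRatio 1 = 1 / 2 := by
    rw [centralRatio_succ, centralRatio_zero]; norm_num
  have hc2 : centralRatio 2 = 3 / 8 := by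
    rw [centralRatio_succ, hc1]; norm_num
  have b11 : K 1 1 < 0 := by
    have := antitone_weight.alternating_series_le_tendsto h11 1
    simp [Finset.sum_range_succ, hw0, hw1] at this
    linarith
  have b11' : -(5 / 2) ≤ K 1 1 := by
    have := antitone_weight.tendsto_le_alternating_series h11 0
    simp [hw0] at this
    linarith
  have b00 : -(5 / 8) ≤ K 0 0 := by
    have hanti : Antitone fun n => weight n * centralRatio (n + 1) ^ 2 := fun m n hmn =>
      mul_le_mul (antitone_weight hmn) (pow_le_pow_left₀ (centralRatio_nonneg _)
        (antitone_centralRatio (Nat.succ_le_succ hmn)) 2) (sq_nonneg _) (weight_pos m).le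
    have := hanti.tendsto_le_alternating_series h00 0
    simp [hw0, hc1] at this
    linarith
  -- First two terms: 5/2 · 1/2 + 9/8 · 3/8.
  have b01 : 107 / 64 ≤ K 0 1 := by
    refine ge_of_tendsto h01 ?_
    filter_upwards [eventually_ge_atTop 2] with N hN
    refine le_trans ?_ (Finset.sum_le_sum_of_subset_of_nonneg
      (Finset.range_subset_range.2 hN) fun n _ _ =>
        mul_nonneg (weight_pos n).le (centralRatio_nonneg _))
    simp only [Finset.sum_range_succ, Finset.sum_range_zero, hw0, hw1, zero_add, hc1,
      show 1 + 1 = 2 from rfl, hc2]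
    norm_num
  refine ⟨h.continuousOn (Frequently.of_forall fun N => Continuous.continuousOn
    (continuous_finsetSum _ fun n _ => continuous_const.mul (continuous_legendreTerm n))),
    hsymm, fun hK => ?_, fun hK => ?_⟩
  · have := hK 1 ![1] ![1] (by simp)
    simp at this
    linarith
  -- K(0,0) + 2K(0,1) + K(1,1) ≥ -5/8 + 107/32 - 5/2 = 7/32 > 0.
  · have := hK 2 ![1, 1] ![0, 1] (by simp [Fin.forall_fin_two])
    simp [Fin.sum_univ_two] at this
    linarith [hsymm 0 hm0 1 hm1]

theorem mercerTerm_eq (n : ℕ) (x y : ℝ) :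
    1 / ((n : ℝ) + 1) ^ 2 * normLegendre (2 * (n + 1)) x *
      ((-1 : ℝ) ^ (n + 1) * normLegendre (2 * (n + 1)) y) =
      (-1 : ℝ) ^ (n + 1) * legendreTerm n (x, y) := by
  have h := normLegendre_mul_normLegendre (2 * (n + 1)) x y
  simp only [legendreTerm, weight]
  rw [show ∀ a b c d : ℝ, a * b * (c * d) = c * (a * (b * d)) by intros; ring, h]
  push_cast
  field_simp
  ring

theorem isContOrthonormal_normLegendre :
    IsContOrthonormal (-1) 1 (fun n => normLegendre (2 * (n + 1))) where
  continuousOn n := (continuous_normLegendre _).continuousOn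
  orthonormal m n := by
    rw [integral_normLegendre_mul]
    exact if_congr (by lia) rfl rfl

theorem isContOrthonormal_alternating_normLegendre :
    IsContOrthonormal (-1) 1 (fun n y => (-1 : ℝ) ^ (n + 1) * normLegendre (2 * (n + 1)) y) where
  continuousOn n := (continuous_const.mul (continuous_normLegendre _)).continuousOn
  orthonormal m n := by
    rw [intervalIntegral.integral_congr fun y _ => mul_mul_mul_comm _ (normLegendre _ y) _ _,
      intervalIntegral.integral_const_mul, isContOrthonormal_normLegendre.orthonormal]
    split_ifs with h
    · rw [h, ← mul_pow]; norm_num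
    · rw [mul_zero]

theorem not_convergesAbsolutely_normLegendre :
    ¬ ConvergesAbsolutely (-1) 1 (-1) 1
      (fun n => 1 / ((n : ℝ) + 1) ^ 2)
      (fun n => normLegendre (2 * (n + 1)))
      (fun n y => (-1 : ℝ) ^ (n + 1) * normLegendre (2 * (n + 1)) y) := fun h => by
  have h1 := h 1 (by norm_num) 1 (by norm_num)
  simp only [mercerTerm_eq, legendreTerm_one_one, abs_mul, abs_pow, abs_neg, abs_one, one_pow,
    one_mul, abs_of_pos (weight_pos _)] at h1
  exact not_summable_weight h1

theorem antitone_one_div_succ_sq : Antitone fun n : ℕ => 1 / ((n : ℝ) + 1) ^ 2 :=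
  fun m n hmn => by
    change 1 / ((n : ℝ) + 1) ^ 2 ≤ 1 / ((m : ℝ) + 1) ^ 2
    gcongr

theorem sum_Icc_normLegendre (N : ℕ) (x y : ℝ) :
    ∑ n ∈ Finset.Icc 1 N, (-1 : ℝ) ^ n / (n : ℝ) ^ 2 * normLegendre (2 * n) x *
      normLegendre (2 * n) y = ∑ n ∈ Finset.range N, (-1 : ℝ) ^ (n + 1) * legendreTerm n (x, y) := by
  induction N with
  | zero => simp
  | succ N ih =>
    rw [Finset.sum_Icc_succ_top (by lia), ih, Finset.sum_range_succ, ← mercerTerm_eq]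
    push_cast
    ring

end MercerKernel

theorem mainTheorem6 :
    -- existence on every compact interval
    (∀ a b : ℝ, a < b →
      ∃ K : ℝ → ℝ → ℝ, MercerKernel.IsContSymmIndefinite a b K ∧
        ∃ (σ : ℕ → ℝ) (u v : ℕ → ℝ → ℝ),
          MercerKernel.IsMercerExpansion a b a b K σ u v ∧
          MercerKernel.ConvergesPointwise a b a b K σ u v ∧
          ¬ MercerKernel.ConvergesAbsolutely a b a b σ u v) ∧
    -- the explicit example on `[-1, 1]`
    (∃ K : ℝ → ℝ → ℝ,
      (∀ x ∈ Icc (-1 : ℝ) 1, ∀ y ∈ Icc (-1 : ℝ) 1,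
        Tendsto (fun N : ℕ => ∑ n ∈ Finset.Icc 1 N,
            (-1 : ℝ) ^ n / (n : ℝ) ^ 2 *
              MercerKernel.normLegendre (2 * n) x * MercerKernel.normLegendre (2 * n) y)
          atTop (𝓝 (K x y))) ∧
      MercerKernel.IsContSymmIndefinite (-1) 1 K ∧
      MercerKernel.IsMercerExpansion (-1) 1 (-1) 1 K
        (fun n => 1 / ((n : ℝ) + 1) ^ 2)
        (fun n => MercerKernel.normLegendre (2 * (n + 1)))
        (fun n y => (-1 : ℝ) ^ (n + 1) * MercerKernel.normLegendre (2 * (n + 1)) y) ∧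
      ¬ MercerKernel.ConvergesAbsolutely (-1) 1 (-1) 1
        (fun n => 1 / ((n : ℝ) + 1) ^ 2)
        (fun n => MercerKernel.normLegendre (2 * (n + 1)))
        (fun n y => (-1 : ℝ) ^ (n + 1) * MercerKernel.normLegendre (2 * (n + 1)) y)) := by
  obtain ⟨K, hK⟩ := MercerKernel.exists_tendstoUniformlyOn_legendreTerm
  have hIndef := MercerKernel.isContSymmIndefinite_of_tendstoUniformlyOn hK
  have hunif : TendstoUniformlyOn (fun (N : ℕ) (p : ℝ × ℝ) => ∑ n ∈ Finset.range N,
      1 / ((n : ℝ) + 1) ^ 2 * MercerKernel.normLegendre (2 * (n + 1)) p.1 *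
        ((-1 : ℝ) ^ (n + 1) * MercerKernel.normLegendre (2 * (n + 1)) p.2))
      (fun p => K p.1 p.2) atTop (Icc (-1 : ℝ) 1 ×ˢ Icc (-1 : ℝ) 1) := by
    simpa only [MercerKernel.mercerTerm_eq] using hK
  have hu := MercerKernel.isContOrthonormal_normLegendre
  have hv := MercerKernel.isContOrthonormal_alternating_normLegendre
  have hpos : ∀ n : ℕ, 0 < 1 / ((n : ℝ) + 1) ^ 2 := fun n => by positivity
  refine ⟨fun a b hab => ?_, K, fun x hx y hy => ?_, hIndef, ?_,
    MercerKernel.not_convergesAbsolutely_normLegendre⟩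
  -- The increasing affine map of [a,b] onto [-1,1] has slope 2/(b - a) and intercept -(a + b)/(b -
  -- a).
  · have hba : 0 < b - a := sub_pos.2 hab
    have hc : 0 < 2 / (b - a) := by positivity
    have ha : 2 / (b - a) * a + -(a + b) / (b - a) = -1 := by field_simp; ring
    have hb : 2 / (b - a) * b + -(a + b) / (b - a) = 1 := by field_simp; ring
    have hunif' := MercerKernel.tendstoUniformlyOn_comp_affine
      (σ := fun n : ℕ => 1 / ((n : ℝ) + 1) ^ 2)
      (u := fun n => MercerKernel.normLegendre (2 * (n + 1)))
      (v := fun n y => (-1 : ℝ) ^ (n + 1) * MercerKernel.normLegendre (2 * (n + 1)) y)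
      hc ha hb hunif
    have hu' := hu.comp_affine hc ha hb
    have hv' := hv.comp_affine hc ha hb
    refine ⟨_, hIndef.comp_affine hc ha hb, fun n : ℕ => 1 / ((n : ℝ) + 1) ^ 2, _, _,
      .of_tendstoUniformlyOn hab.le hpos MercerKernel.antitone_one_div_succ_sq hu' hv' hunif',
      MercerKernel.convergesPointwise_of_tendstoUniformlyOn hunif', fun h => ?_⟩
    exact MercerKernel.not_convergesAbsolutely_normLegendre
      (MercerKernel.ConvergesAbsolutely.of_comp_affine hc ha hb h)
  · simp only [MercerKernel.sum_Icc_normLegendre]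
    exact hK.tendsto_at (x := (x, y)) ⟨hx, hy⟩
  · exact .of_tendstoUniformlyOn (by norm_num) hpos MercerKernel.antitone_one_div_succ_sq
      hu hv hunif
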